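/- Let $p\ge 0$ be an integer, let $\mathbf{F}_{2p}=\langle a_1,\dots,a_p,b_1,\dots,b_p\rangle$ be the free group of rank $2p$, and let $C=\langle\kappa\rangle$ be the cyclic subgroup generated by the product of commutators $\kappa=\prod_{i=1}^{p}[a_i,b_i]$, where $[a,b]=aba^{-1}b^{-1}$. Then $C$ is a measure free-factor of $\mathbf{F}_{2p}$. That is, there exist a standard Borel probability space $(X,\mu)$, an essentially free measure-preserving Borel action of $\mathbf{F}_{2p}$ on $(X,\mu)$, with orbit equivalence relation $\mathcal{R}$, and a Borel equivalence relation $\mathcal{S}\subseteq\mathcal{R}$ on $X$ such that $\mathcal{R}=\mathcal{R}_C*\mathcal{S}$, where $\mathcal{R}_C$ is the orbit equivalence relation of the restriction of the action to $C$. Here $\mathcal{R}=\mathcal{R}_C*\mathcal{S}$ means that, up to a $\mu$-null set: (i) $\mathcal{R}$ is the smallest equivalence relation containing $\mathcal{R}_C$ and $\mathcal{S}$; and (ii) for every $n\ge 1$ and every tuple $(x_j)_{j\in\mathbb{Z}/2n\mathbb{Z}}$ of points of $X$ such that $(x_{2i-1},x_{2i})\in\mathcal{R}_C$ and $(x_{2i},x_{2i+1})\in\mathcal{S}$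 for all $i$, there is a $j$ with $x_j=x_{j+1}$. -/

import Mathlib

open MeasureTheory

/-- An action of `Γ` on the measure space `(X, μ)` is (essentially) free if almost every point has
trivial stabilizer. -/
def IsEssentiallyFree (Γ : Type*) {X : Type*} [Group Γ] [MulAction Γ X] [MeasurableSpace X]
    (μ : Measure X) : Prop :=
  ∀ᵐ x ∂μ, MulAction.stabilizer Γ x = ⊥

/-- The equivalence relation `R` on `(X, μ)` splits as the free product `R = R₁ * R₂` of its
subrelations `R₁` and `R₂`: up to a null set, `R` is generated by `R₁` and `R₂`, and every
closed `2n`-tuple whose consecutive points are alternately `R₁`- and `R₂`-equivalent has two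
consecutive points that are equal. (`R₁ ⊔ R₂` is the smallest equivalence relation containing
`R₁` and `R₂`.) -/
structure IsFreeProductRel {X : Type*} [MeasurableSpace X] (μ : Measure X)
    (R R₁ R₂ : Setoid X) : Prop where
  left_le : R₁ ≤ R
  right_le : R₂ ≤ R
  generates : ∀ᵐ x ∂μ, ∀ y, R x y → (R₁ ⊔ R₂) x y
  no_reduced_cycle : ∀ᵐ x₀ ∂μ, ∀ n : ℕ, 1 ≤ n → ∀ x : ZMod (2 * n) → X, x 0 = x₀ →
    (∀ i : ZMod (2 * n), R₁ (x (2 * i - 1)) (x (2 * i)) ∧ R₂ (x (2 * i)) (x (2 * i + 1))) →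
      ∃ j : ZMod (2 * n), x j = x (j + 1)

/-- `Λ` is a measure free-factor of the countable group `Γ`: for some (essentially) free
probability measure preserving action of `Γ` on a standard Borel probability space, there is a
Borel subrelation `S` of the orbit relation of `Γ` such that the orbit relation of `Γ` is the free
product of the orbit relation of `Λ` and `S`. (The classes of such an `S` are countable and `S`
preserves `μ`, since this holds for the orbit relation of `Γ`.) -/
def IsMeasureFreeFactor {Γ : Type*} [Group Γ] [Countable Γ] (Λ : Subgroup Γ) : Prop :=
  ∃ (X : Type) (_ : MeasurableSpace X) (_ : StandardBorelSpace X)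
    (μ : Measure X) (_ : IsProbabilityMeasure μ)
    (_ : MulAction Γ X) (_ : MeasurableConstSMul Γ X) (_ : SMulInvariantMeasure Γ X μ),
    IsEssentiallyFree Γ μ ∧
    ∃ S : Setoid X, MeasurableSet {q : X × X | S q.1 q.2} ∧
      IsFreeProductRel μ (MulAction.orbitRel Γ X) (MulAction.orbitRel Λ X) S

/-- The element `κ = [a₁, b₁] [a₂, b₂] ⋯ [a_p, b_p]` of the free group on
`a₁, …, a_p, b₁, …, b_p`, where `a_i` and `b_i` are the generators indexed by `Sum.inl i` and
`Sum.inr i`, and `[a, b] = a b a⁻¹ b⁻¹`. -/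
def prodCommutators (p : ℕ) : FreeGroup (Fin p ⊕ Fin p) :=
  let a : Fin p → FreeGroup (Fin p ⊕ Fin p) := fun i => FreeGroup.of (Sum.inl i)
  let b : Fin p → FreeGroup (Fin p ⊕ Fin p) := fun i => FreeGroup.of (Sum.inr i)
  (List.ofFn fun i : Fin p => a i * b i * (a i)⁻¹ * (b i)⁻¹).prod

/-! For p ≥ 1 write κ = [a, b] w, with w a word in the generators other than a and b. Let S be
generated by the edges of the other generators together with, at each point u, exactly one of the
edges u → a u (if u ∈ D) and u → b u (if u ∉ D). The square with corners u, a u, b u, b a u, a b u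
is closed up by the κ-edge from w⁻¹ b a u to a b u, since w moves points inside S-classes. So
removed edges and κ-edges are matched one to one by the base point u.

Suppose a rank ℓ decreases along every removed edge, as `hD` and `hD'` provide. Apart from the
removed edge based at u, the square at u involves only removed edges based at points of smaller
rank. This triangular system is used twice. By induction on ℓ, each removed edge lies in the join of
S and the orbits of κ (`orbitRel_le_sup_keptRel`). By recursion on ℓ, the removed edges can be
labelled so that the κ-edges carry independent free generators (`exists_edgeLabels`). The resulting
function F is constant on S-classes, and a reduced alternating cycle would spell a nonempty reduced
word equal to 1 (`alternating_path_ne`).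

Such D and ℓ come from coin sequences, with a flipping a coordinate and b shifting. A Bernoulli
factor makes the action free. -/

/-- A function on a free group with prescribed multiplicative increments along the edges of the
Cayley tree. -/
theorem FreeGroup.exists_increments {α G : Type*} [Group G] (c : α → FreeGroup α → G) :
    ∃ F : FreeGroup α → G, ∀ s h, F (FreeGroup.of s * h) = c s h * F h := by
  -- Skew product over left translation: the orbit of (1, 1) is the graph of F.
  let e : α → Equiv.Perm (FreeGroup α × G) := fun s =>
    { toFun := fun q => (FreeGroup.of s * q.1, c s q.1 * q.2)
      invFun := fun q => ((FreeGroup.of s)⁻¹ * q.1, (c s ((FreeGroup.of s)⁻¹ * q.1))⁻¹ * q.2)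
      left_inv := fun q => by simp
      right_inv := fun q => by simp }
  have he : ∀ s q, e s q = (FreeGroup.of s * q.1, c s q.1 * q.2) := fun _ _ => rfl
  have he' : ∀ s q, ((e s)⁻¹ q).1 = (FreeGroup.of s)⁻¹ * q.1 := fun _ _ => rfl
  have hfst : ∀ h q, (FreeGroup.lift e h q).1 = h * q.1 := by
    intro h
    induction h using FreeGroup.induction_on with
    | C1 => simp
    | of s => simp [he]
    | inv_of s _ => intro q; rw [_root_.map_inv, FreeGroup.lift_apply_of]; exact he' s q
    | mul x y hx hy => intro q; simp [hx, hy, mul_assoc]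
  refine ⟨fun h => (FreeGroup.lift e h (1, 1)).2, fun s h => ?_⟩
  simp [he, hfst]

/-! ### Labelling the squares by recursion on the rank -/

section SquareLabel

variable {Γ G : Type*} [Group Γ] [Group G]

open Classical in
/-- The labels of the distinguished edges of the squares `u, b u, a b u` / `u, a u, b a u`, defined
by recursion on the rank `ℓ` so that the boundary of the square at `u` has label `t u`. -/
noncomputable def squareLabel (a b : Γ) (D : Set Γ) (ℓ : Γ → ℕ) (t : Γ → G) (u : Γ) : G :=
  -- The rank tests serve termination only. Under the hypotheses of `exists_edgeLabels` they hold
  -- whenever the neighbouring edge is removed, so the default 1 is harmless.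
  let A : G := if _ : ℓ (b * u) < ℓ u then if b * u ∈ D then 1 else
    squareLabel a b D ℓ t (b * u) else 1
  let B : G := if _ : ℓ (a * u) < ℓ u then if a * u ∈ D then
    squareLabel a b D ℓ t (a * u) else 1 else 1
  if u ∈ D then A⁻¹ * t u * B else B⁻¹ * (t u)⁻¹ * A
termination_by ℓ u

/-- With A and B the increments of F along a- and b-edges, the left side of the last identity is F(a
b u) F(b a u)⁻¹. Exactly one of A u, B u is free, and the other unknowns have smaller rank, so the
equation at u can be solved for it. -/
theorem exists_edgeLabels (a b : Γ) (D : Set Γ) (ℓ : Γ → ℕ) (t : Γ → G)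
    (hD : ∀ u ∈ D, ℓ u < ℓ (a⁻¹ * u)) (hD' : ∀ u, u ∉ D → ℓ u < ℓ (b⁻¹ * u)) :
    ∃ A B : Γ → G, (∀ u ∈ D, A u = 1) ∧ (∀ u, u ∉ D → B u = 1) ∧
      ∀ u, A (b * u) * B u * (A u)⁻¹ * (B (a * u))⁻¹ = t u := by
  classical
  refine ⟨fun u => if u ∈ D then 1 else squareLabel a b D ℓ t u,
    fun u => if u ∈ D then squareLabel a b D ℓ t u else 1,
    fun u hu => if_pos hu, fun u hu => if_neg hu, fun u => ?_⟩
  have hb : b * u ∉ D → ℓ (b * u) < ℓ u := fun h => by simpa using hD' _ h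
  have ha : a * u ∈ D → ℓ (a * u) < ℓ u := fun h => by simpa using hD _ h
  by_cases hu : u ∈ D <;> by_cases h1 : b * u ∈ D <;> by_cases h2 : a * u ∈ D <;>
    simp only [hu, h1, h2, if_true, if_false, one_mul, mul_one, inv_one] <;>
    rw [squareLabel.eq_def a b D ℓ t u] <;>
    simp [hu, h1, h2, ha, hb, mul_assoc]

end SquareLabel

/-! ### Reduced words along alternating paths -/

section ReducedCycle

variable {Γ : Type*} [Group Γ]

/-- The point reached after crossing the edge from `h` to `κ * h` labelled by `h`, in the direction
given by the exponent of the letter. -/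
def letterTarget (κ : Γ) (l : Γ × Bool) : Γ := if l.2 then κ * l.1 else l.1

variable {κ : Γ} {F : Γ → FreeGroup Γ}

/-- The head of L is the last edge crossed. A new letter leaving h could cancel only against a
letter arriving at h, which `hhead` excludes; later letters of the same power share one sign. -/
theorem exists_reduced_word_pow (hF : ∀ h, F (κ * h) = FreeGroup.of h * F h) (h : Γ)
    (L : List (Γ × Bool)) (hL : FreeGroup.IsReduced L)
    (hhead : ∀ l ∈ L.head?, letterTarget κ l ≠ h) (q : FreeGroup Γ)
    (hq : F h = FreeGroup.mk L * q) (m : ℕ) :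
    ∃ L', FreeGroup.IsReduced ((κ ^ m * h, true) :: L') ∧
      F (κ ^ (m + 1) * h) = FreeGroup.mk ((κ ^ m * h, true) :: L') * q := by
  have key : ∀ (x : Γ) (L : List (Γ × Bool)), FreeGroup.mk ((x, true) :: L) =
      FreeGroup.of x * FreeGroup.mk L := fun x L => by
    simp [FreeGroup.of, FreeGroup.mul_mk]
  induction m with
  | zero =>
    refine ⟨L, ?_, ?_⟩
    · cases L with
      | nil => exact FreeGroup.IsReduced.singleton
      | cons l L =>
        refine FreeGroup.isReduced_cons_cons.2 ⟨fun e => ?_, hL⟩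
        obtain ⟨y, b⟩ := l
        cases b
        · simp [letterTarget] at hhead e
          exact absurd e.symm hhead
        · rfl
    · rw [key]; simp [hF, hq, mul_assoc]
  | succ m ih =>
    obtain ⟨L', h1, h2⟩ := ih
    refine ⟨(κ ^ m * h, true) :: L', FreeGroup.isReduced_cons_cons.2 ⟨fun _ => rfl, h1⟩, ?_⟩
    rw [key, mul_assoc, ← h2, ← hF, ← mul_assoc, ← pow_succ']

theorem exists_reduced_word_inv_pow (hF : ∀ h, F (κ * h) = FreeGroup.of h * F h) (h : Γ)
    (L : List (Γ × Bool)) (hL : FreeGroup.IsReduced L)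
    (hhead : ∀ l ∈ L.head?, letterTarget κ l ≠ h) (q : FreeGroup Γ)
    (hq : F h = FreeGroup.mk L * q) (m : ℕ) :
    ∃ L', FreeGroup.IsReduced ((κ⁻¹ ^ (m + 1) * h, false) :: L') ∧
      F (κ⁻¹ ^ (m + 1) * h) = FreeGroup.mk ((κ⁻¹ ^ (m + 1) * h, false) :: L') * q := by
  have key : ∀ (x : Γ) (L : List (Γ × Bool)), FreeGroup.mk ((x, false) :: L) =
      (FreeGroup.of x)⁻¹ * FreeGroup.mk L := fun x L => by
    simp [FreeGroup.of, FreeGroup.mul_mk, FreeGroup.inv_mk, FreeGroup.invRev]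
  have hF' : ∀ h, F (κ⁻¹ * h) = (FreeGroup.of (κ⁻¹ * h))⁻¹ * F h := fun h => by
    rw [eq_inv_mul_iff_mul_eq, ← hF, mul_inv_cancel_left]
  induction m with
  | zero =>
    refine ⟨L, ?_, ?_⟩
    · cases L with
      | nil => exact FreeGroup.IsReduced.singleton
      | cons l L =>
        refine FreeGroup.isReduced_cons_cons.2 ⟨fun e => ?_, hL⟩
        obtain ⟨y, b⟩ := l
        cases b
        · rfl
        · simp [letterTarget] at hhead e
          exact absurd (by rw [← e]; simp) hhead
    · rw [key]; simp [hF', hq, mul_assoc]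
  | succ m ih =>
    obtain ⟨L', h1, h2⟩ := ih
    refine ⟨(κ⁻¹ ^ (m + 1) * h, false) :: L',
      FreeGroup.isReduced_cons_cons.2 ⟨fun _ => rfl, h1⟩, ?_⟩
    rw [key, mul_assoc, ← h2, pow_succ' κ⁻¹ (m + 1), mul_assoc, ← hF']

theorem exists_reduced_word_zpow (hF : ∀ h, F (κ * h) = FreeGroup.of h * F h) (h : Γ)
    (L : List (Γ × Bool)) (hL : FreeGroup.IsReduced L)
    (hhead : ∀ l ∈ L.head?, letterTarget κ l ≠ h) (q : FreeGroup Γ)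
    (hq : F h = FreeGroup.mk L * q) (m : ℤ) (hm : m ≠ 0) :
    ∃ L', L' ≠ [] ∧ FreeGroup.IsReduced L' ∧ (∀ l ∈ L'.head?, letterTarget κ l = κ ^ m * h) ∧
      F (κ ^ m * h) = FreeGroup.mk L' * q := by
  obtain ⟨k, rfl | rfl⟩ := m.eq_nat_or_neg
  · obtain ⟨k, rfl⟩ : ∃ j, k = j + 1 := Nat.exists_eq_succ_of_ne_zero (by simpa using hm)
    obtain ⟨L', h1, h2⟩ := exists_reduced_word_pow hF h L hL hhead q hq k
    refine ⟨_, List.cons_ne_nil _ _, h1, ?_, ?_⟩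
    · simp only [List.head?_cons, Option.mem_def, Option.some.injEq, forall_eq', letterTarget,
        if_true]
      rw [← mul_assoc, ← pow_succ', zpow_natCast]
    · rw [zpow_natCast, h2]
  · obtain ⟨k, rfl⟩ : ∃ j, k = j + 1 := Nat.exists_eq_succ_of_ne_zero (by simpa using hm)
    obtain ⟨L', h1, h2⟩ := exists_reduced_word_inv_pow hF h L hL hhead q hq k
    have e : κ ^ (-((k + 1 : ℕ) : ℤ)) = κ⁻¹ ^ (k + 1) := by
      rw [zpow_neg, zpow_natCast, inv_pow]
    refine ⟨_, List.cons_ne_nil _ _, h1, ?_, ?_⟩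
    · simp only [List.head?_cons, Option.mem_def, Option.some.injEq, forall_eq', letterTarget, e]
      rfl
    · rw [e, h2]

/-- A path alternating between nontrivial powers of `κ` and nontrivial steps along which `F` is
constant cannot return to the level set of `F` it started from. -/
theorem alternating_path_ne (hF : ∀ h, F (κ * h) = FreeGroup.of h * F h) (g : ℕ → Γ)
    (hg : ∀ i, F (g (2 * i + 1)) = F (g (2 * i))) (hne : ∀ i, g (2 * i) ≠ g (2 * i + 1))
    (hκ : ∀ i, ∃ m : ℤ, m ≠ 0 ∧ g (2 * (i + 1)) = κ ^ m * g (2 * i + 1)) (n : ℕ) (hn : 1 ≤ n) :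
    F (g (2 * n)) ≠ F (g 0) := by
  have key : ∀ k, ∃ L, (1 ≤ k → L ≠ []) ∧ FreeGroup.IsReduced L ∧
      (∀ l ∈ L.head?, letterTarget κ l = g (2 * k)) ∧
      F (g (2 * k)) = FreeGroup.mk L * F (g 0) := by
    intro k
    induction k with
    | zero => exact ⟨[], by simp, FreeGroup.IsReduced.nil, by simp,
        by rw [← FreeGroup.one_eq_mk, one_mul]⟩
    | succ k ih =>
      obtain ⟨L, -, h1, h2, h3⟩ := ih
      obtain ⟨m, hm, e⟩ := hκ k
      -- The step with F constant leaves the endpoint of the last κ-edge, which is precisely the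
      -- non-cancellation condition for the next power.
      obtain ⟨L', h4, h5, h6, h7⟩ := exists_reduced_word_zpow hF (g (2 * k + 1)) L h1
        (fun l hl => by rw [h2 l hl]; exact hne k) (F (g 0)) (by rw [hg, h3]) m hm
      exact ⟨L', fun _ => h4, h5, by rwa [e], by rwa [e]⟩
  classical
  obtain ⟨L, h1, h2, -, h3⟩ := key n
  intro h
  rw [h, eq_comm, mul_eq_right, FreeGroup.one_eq_mk] at h3
  have := FreeGroup.reduce.sound h3
  rw [h2.reduce_eq] at this
  exact h1 hn (by simpa using this)

end ReducedCycle

/-! ### The complementary relation generated by kept edges -/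

section KeptRel

variable {α X : Type*} [MulAction (FreeGroup α) X]

/-- The points `x` from which the edge to `s • x` is kept: `a`-edges are kept on `D`, `b`-edges are
kept off `D`, and the edges of all other generators are kept everywhere. -/
def keptEdge (a b : α) (D : Set X) (s : α) : Set X :=
  {x | (s = a → x ∈ D) ∧ (s = b → x ∉ D)}

/-- The equivalence relation generated by the kept edges. -/
def keptRel (a b : α) (D : Set X) : Setoid X :=
  Relation.EqvGen.setoid fun x y => ∃ s, x ∈ keptEdge a b D s ∧ y = FreeGroup.of s • x

variable {a b : α} {D : Set X}

theorem keptRel_of_mem {s : α} {x : X} (h : x ∈ keptEdge a b D s) :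
    keptRel a b D x (FreeGroup.of s • x) :=
  Relation.EqvGen.rel _ _ ⟨s, h, rfl⟩

theorem keptRel_le_orbitRel : keptRel a b D ≤ MulAction.orbitRel (FreeGroup α) X := by
  intro x y h
  induction h with
  | rel x y h =>
    obtain ⟨s, -, rfl⟩ := h
    exact (MulAction.orbitRel (FreeGroup α) X).symm (MulAction.mem_orbit _ _)
  | refl x => exact Setoid.refl' _ x
  | symm x y _ ih => exact Setoid.symm' _ ih
  | trans x y z _ _ ih ih' => exact Setoid.trans' _ ih ih'

theorem keptRel_smul_of_mem_closure {w : FreeGroup α}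
    (hw : w ∈ Subgroup.closure (FreeGroup.of '' {s | s ≠ a ∧ s ≠ b})) (x : X) :
    keptRel a b D x (w • x) := by
  induction hw using Subgroup.closure_induction generalizing x with
  | mem g hg =>
    obtain ⟨s, ⟨h1, h2⟩, rfl⟩ := hg
    exact keptRel_of_mem ⟨fun h => absurd h h1, fun h => absurd h h2⟩
  | one => rw [one_smul]
  | mul g h _ _ ihg ihh => rw [mul_smul]; exact Setoid.trans' _ (ihh x) (ihg _)
  | inv g _ ih =>
    have := ih (g⁻¹ • x)
    rw [smul_inv_smul] at this
    exact Setoid.symm' _ this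

theorem measurableSet_keptRel [Countable α] [MeasurableSpace X] [StandardBorelSpace X]
    [MeasurableConstSMul (FreeGroup α) X] (hD : MeasurableSet D) :
    MeasurableSet {q : X × X | keptRel a b D q.1 q.2} := by
  have hK : ∀ s, MeasurableSet (keptEdge a b D s) := fun s => by
    have h : ∀ (q : Prop) (E : Set X), MeasurableSet E → MeasurableSet {x | q → x ∈ E} :=
      fun q E hE => by by_cases hq : q <;> simp [hq, hE]
    exact (h _ D hD).inter (h _ Dᶜ hD.compl)
  -- The n-th iterate on the diagonal consists of the pairs joined by a path of n kept edges,
  -- crossed in either direction.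
  let Φ : Set (X × X) → Set (X × X) := fun P => ⋃ s : α,
    ({q | q.1 ∈ keptEdge a b D s} ∩ {q | (FreeGroup.of s • q.1, q.2) ∈ P}) ∪
    ({q | (FreeGroup.of s)⁻¹ • q.1 ∈ keptEdge a b D s} ∩
      {q | ((FreeGroup.of s)⁻¹ • q.1, q.2) ∈ P})
  have hΦ : ∀ n, MeasurableSet (Φ^[n] {q | q.1 = q.2}) := by
    intro n
    induction n with
    | zero => exact measurableSet_eq_fun measurable_fst measurable_snd
    | succ n ih =>
      rw [Function.iterate_succ']
      refine MeasurableSet.iUnion fun s => MeasurableSet.union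
        (MeasurableSet.inter (measurable_fst (hK s)) ?_) (MeasurableSet.inter ?_ ?_)
      · exact ((measurable_fst.const_smul _).prodMk measurable_snd) ih
      · exact (measurable_fst.const_smul _) (hK s)
      · exact ((measurable_fst.const_smul _).prodMk measurable_snd) ih
  have hle : ∀ n x y, (x, y) ∈ Φ^[n] {q | q.1 = q.2} → keptRel a b D x y := by
    intro n
    induction n with
    | zero => rintro x y h; exact (show x = y from h) ▸ Setoid.refl' _ x
    | succ n ih =>
      intro x y h
      rw [Function.iterate_succ'] at h
      obtain ⟨s, ⟨h1, h2⟩ | ⟨h1, h2⟩⟩ := Set.mem_iUnion.1 h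
      · exact Setoid.trans' _ (keptRel_of_mem h1) (ih _ _ h2)
      · have := keptRel_of_mem (x := (FreeGroup.of s)⁻¹ • x) h1
        rw [smul_inv_smul] at this
        exact Setoid.trans' _ (Setoid.symm' _ this) (ih _ _ h2)
  have hge : ∀ x y, keptRel a b D x y → ∀ z, (∃ n, (x, z) ∈ Φ^[n] {q | q.1 = q.2}) ↔
      ∃ n, (y, z) ∈ Φ^[n] {q | q.1 = q.2} := by
    intro x y h
    induction h with
    | rel x y h =>
      obtain ⟨s, hs, rfl⟩ := h
      refine fun z => ⟨fun ⟨n, hn⟩ => ⟨n + 1, ?_⟩, fun ⟨n, hn⟩ => ⟨n + 1, ?_⟩⟩ <;>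
        rw [Function.iterate_succ']
      · exact Set.mem_iUnion.2 ⟨s, Or.inr ⟨by simpa using hs, by simpa using hn⟩⟩
      · exact Set.mem_iUnion.2 ⟨s, Or.inl ⟨hs, hn⟩⟩
    | refl x => exact fun z => Iff.rfl
    | symm x y _ ih => exact fun z => (ih z).symm
    | trans x y z _ _ ih ih' => exact fun t => (ih t).trans (ih' t)
  have : {q : X × X | keptRel a b D q.1 q.2} = ⋃ n, Φ^[n] {q | q.1 = q.2} := by
    ext ⟨x, y⟩
    refine ⟨fun h => Set.mem_iUnion.2 ((hge x y h y).2 ⟨0, rfl⟩), fun h => ?_⟩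
    obtain ⟨n, hn⟩ := Set.mem_iUnion.1 h
    exact hle n x y hn
  rw [this]
  exact MeasurableSet.iUnion hΦ

variable {w : FreeGroup α} {ℓ : X → ℕ} {x₀ : X}

open FreeGroup in
/-- On an orbit where the rank `ℓ` increases across the removed edges, the removed edges are
recovered from the kept ones and the orbits of `[a, b] w`. -/
theorem orbitRel_le_sup_keptRel (hab : a ≠ b)
    (hw : w ∈ Subgroup.closure (FreeGroup.of '' {s | s ≠ a ∧ s ≠ b}))
    (hD : ∀ g : FreeGroup α, g • x₀ ∈ D → ℓ (g • x₀) < ℓ ((of a)⁻¹ • g • x₀))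
    (hD' : ∀ g : FreeGroup α, g • x₀ ∉ D → ℓ (g • x₀) < ℓ ((of b)⁻¹ • g • x₀))
    (y : X) (hy : MulAction.orbitRel (FreeGroup α) X x₀ y) :
    (MulAction.orbitRel (Subgroup.zpowers (of a * of b * (of a)⁻¹ * (of b)⁻¹ * w)) X ⊔
      keptRel a b D) x₀ y := by
  set κ := of a * of b * (of a)⁻¹ * (of b)⁻¹ * w with hκ
  set T := MulAction.orbitRel (Subgroup.zpowers κ) X ⊔ keptRel a b D with hT
  have hS : ∀ {x y}, keptRel a b D x y → T x y := fun h => (le_sup_right : _ ≤ T) h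
  have hC : ∀ x, T x (κ • x) := fun x => (le_sup_left : _ ≤ T)
    (Setoid.symm' _ ⟨⟨κ, Subgroup.mem_zpowers κ⟩, rfl⟩)
  have hka : ∀ {u : X}, u ∈ D → T u (of a • u) := fun hu =>
    hS (keptRel_of_mem ⟨fun _ => hu, fun h => absurd h hab⟩)
  have hkb : ∀ {u : X}, u ∉ D → T u (of b • u) := fun hu =>
    hS (keptRel_of_mem ⟨fun h => absurd h.symm hab, fun _ => hu⟩)
  -- The top of the square: κ sends w⁻¹ b a u to a b u, and w⁻¹ b a u is S-equivalent to b a u.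
  have hsq : ∀ u, T (of b • of a • u) (of a • of b • u) := fun u => by
    have h1 := keptRel_smul_of_mem_closure (a := a) (b := b) (D := D) hw (w⁻¹ • of b • of a • u)
    have h2 := hC (w⁻¹ • of b • of a • u)
    rw [smul_inv_smul] at h1
    have e : κ • w⁻¹ • of b • of a • u = of a • of b • u := by
      simp only [hκ, smul_smul]; congr 1; group
    rw [e] at h2
    exact Setoid.trans' _ (Setoid.symm' _ (hS h1)) h2
  -- Induction on rank: an upper side of the square at u is either kept or based at a point of
  -- smaller rank. Three sides then give the fourth.
  have hab' : ∀ n : ℕ, ∀ u ∈ MulAction.orbit (FreeGroup α) x₀, ℓ u = n →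
      T u (of a • u) ∧ T u (of b • u) := by
    intro n
    induction n using Nat.strong_induction_on with
    | _ n ih =>
      intro u hu hn
      have h1 : T (of a • u) (of b • of a • u) := by
        by_cases h : of a • u ∈ D
        · obtain ⟨g, rfl⟩ := hu
          have := hD (of a * g) (by rwa [mul_smul])
          rw [mul_smul, inv_smul_smul] at this
          exact (ih _ (hn ▸ this) _ ⟨of a * g, mul_smul _ _ _⟩ rfl).2
        · exact hkb h
      have h2 : T (of b • u) (of a • of b • u) := by
        by_cases h : of b • u ∈ D
        · exact hka h
        · obtain ⟨g, rfl⟩ := hu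
          have := hD' (of b * g) (by rwa [mul_smul])
          rw [mul_smul, inv_smul_smul] at this
          exact (ih _ (hn ▸ this) _ ⟨of b * g, mul_smul _ _ _⟩ rfl).1
      have h3 : T (of a • u) (of b • u) :=
        Setoid.trans' _ h1 (Setoid.trans' _ (hsq u) (Setoid.symm' _ h2))
      by_cases h : u ∈ D
      · exact ⟨hka h, Setoid.trans' _ (hka h) h3⟩
      · exact ⟨Setoid.trans' _ (hkb h) (Setoid.symm' _ h3), hkb h⟩
  have hgen : ∀ s, ∀ u ∈ MulAction.orbit (FreeGroup α) x₀, T u (of s • u) := fun s u hu => by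
    by_cases h1 : s = a
    · exact h1 ▸ (hab' _ u hu rfl).1
    by_cases h2 : s = b
    · exact h2 ▸ (hab' _ u hu rfl).2
    exact hS (keptRel_of_mem ⟨fun h => absurd h h1, fun h => absurd h h2⟩)
  have hall : ∀ g : FreeGroup α, ∀ u ∈ MulAction.orbit (FreeGroup α) x₀, T u (g • u) := by
    intro g
    induction g using FreeGroup.induction_on with
    | C1 => intro u _; rw [one_smul]
    | of s => exact hgen s
    | inv_of s _ =>
      rintro u ⟨h, rfl⟩
      have := hgen s ((of s)⁻¹ • h • x₀) ⟨(of s)⁻¹ * h, mul_smul _ _ _⟩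
      rw [smul_inv_smul] at this
      exact Setoid.symm' _ this
    | mul g h hg hh =>
      rintro u ⟨k, rfl⟩
      rw [mul_smul]
      exact Setoid.trans' _ (hh _ ⟨k, rfl⟩) (hg _ ⟨h * k, mul_smul _ _ _⟩)
  obtain ⟨g, rfl⟩ := Setoid.symm' _ hy
  exact hall g x₀ (MulAction.mem_orbit_self x₀)

open FreeGroup in
/-- On a free orbit where the rank `ℓ` increases across the removed edges, there is a function to a
free group that is constant along the kept edges and gets multiplied by distinct free generators
along the edges of `[a, b] w`. -/
theorem exists_separating_function (hab : a ≠ b)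
    (hw : w ∈ Subgroup.closure (FreeGroup.of '' {s | s ≠ a ∧ s ≠ b}))
    (hfree : ∀ g h : FreeGroup α, g • x₀ = h • x₀ → g = h)
    (hD : ∀ g : FreeGroup α, g • x₀ ∈ D → ℓ (g • x₀) < ℓ ((of a)⁻¹ • g • x₀))
    (hD' : ∀ g : FreeGroup α, g • x₀ ∉ D → ℓ (g • x₀) < ℓ ((of b)⁻¹ • g • x₀)) :
    ∃ F : FreeGroup α → FreeGroup (FreeGroup α),
      (∀ g h : FreeGroup α, keptRel a b D (g • x₀) (h • x₀) → F g = F h) ∧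
      ∀ h, F (of a * of b * (of a)⁻¹ * (of b)⁻¹ * w * h) = of h * F h := by
  classical
  -- The label prescribed for the square at u is the generator named by the source w⁻¹ b a u of its
  -- κ-edge.
  obtain ⟨A, B, hA, hB, hAB⟩ := exists_edgeLabels (of a) (of b) {g : FreeGroup α | g • x₀ ∈ D}
    (fun g => ℓ (g • x₀)) (fun u => of (w⁻¹ * of b * of a * u))
    (fun u hu => by simpa [mul_smul] using hD u hu)
    (fun u hu => by simpa [mul_smul] using hD' u hu)
  obtain ⟨F, hF⟩ := FreeGroup.exists_increments
    (fun s h => if s = a then A h else if s = b then B h else 1)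
  have hFa : ∀ h, F (of a * h) = A h * F h := fun h => by simp [hF]
  have hFb : ∀ h, F (of b * h) = B h * F h := fun h => by simp [hF, hab.symm]
  have hK : ∀ x y, keptRel a b D x y → ∀ g h : FreeGroup α, g • x₀ = x → h • x₀ = y →
      F g = F h := by
    intro x y hxy
    induction hxy with
    | rel x y h =>
      obtain ⟨s, ⟨h1, h2⟩, rfl⟩ := h
      rintro g h rfl hh
      obtain rfl : h = of s * g := hfree _ _ (by rw [hh, mul_smul])
      rw [hF]
      by_cases ha : s = a
      · simp [ha, hA g (h1 ha)]
      by_cases hb : s = b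
      · simp [hb, hab.symm, hB g (h2 hb)]
      simp [ha, hb]
    | refl x => rintro g h rfl hh; rw [hfree _ _ hh]
    | symm x y _ ih => exact fun g h hg hh => (ih h g hh hg).symm
    | trans x y z hxy _ ih ih' =>
      rintro g h rfl hh
      obtain ⟨k, rfl⟩ := Setoid.symm' _ (keptRel_le_orbitRel hxy)
      exact (ih g (k * g) rfl (mul_smul _ _ _)).trans (ih' (k * g) h (mul_smul _ _ _) hh)
  have hK' : ∀ g h : FreeGroup α, keptRel a b D (g • x₀) (h • x₀) → F g = F h :=
    fun g h hgh => hK _ _ hgh g h rfl rfl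
  refine ⟨F, hK', fun h => ?_⟩
  have hFw : F (w * h) = F h := by
    refine (hK' _ _ ?_).symm
    rw [mul_smul]
    exact keptRel_smul_of_mem_closure hw _
  obtain ⟨u, rfl⟩ : ∃ u, h = w⁻¹ * (of b * (of a * u)) := ⟨(of a)⁻¹ * (of b)⁻¹ * w * h, by group⟩
  have e : of a * of b * (of a)⁻¹ * (of b)⁻¹ * w * (w⁻¹ * (of b * (of a * u))) =
      of a * (of b * u) := by group
  rw [mul_inv_cancel_left] at hFw
  rw [e, ← hFw, hFa, hFb, hFb, hFa]
  have := hAB u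
  simp only [mul_assoc] at this ⊢
  rw [← this]
  group

end KeptRel

-- The rank inequalities hold almost everywhere; countability and invariance make them hold along
-- almost every whole orbit, where the combinatorial results apply.
open FreeGroup in
theorem isFreeProductRel_keptRel {α X : Type*} [Countable α] [MulAction (FreeGroup α) X]
    [MeasurableSpace X] [MeasurableConstSMul (FreeGroup α) X] (μ : Measure X)
    [SMulInvariantMeasure (FreeGroup α) X μ] (hfree : IsEssentiallyFree (FreeGroup α) μ)
    {a b : α} (hab : a ≠ b) {w : FreeGroup α}
    (hw : w ∈ Subgroup.closure (FreeGroup.of '' {s | s ≠ a ∧ s ≠ b})) (D : Set X) (ℓ : X → ℕ)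
    (hD : ∀ᵐ x ∂μ, x ∈ D → ℓ x < ℓ ((of a)⁻¹ • x))
    (hD' : ∀ᵐ x ∂μ, x ∉ D → ℓ x < ℓ ((of b)⁻¹ • x)) :
    IsFreeProductRel μ (MulAction.orbitRel (FreeGroup α) X)
      (MulAction.orbitRel (Subgroup.zpowers (of a * of b * (of a)⁻¹ * (of b)⁻¹ * w)) X)
      (keptRel a b D) := by
  have hcount : Countable (FreeGroup α) := inferInstance
  have hinv : ∀ (p : X → Prop), (∀ᵐ x ∂μ, p x) → ∀ᵐ x ∂μ, ∀ g : FreeGroup α, p (g • x) :=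
    fun p hp => ae_all_iff.2 fun g => (measurePreserving_smul g μ).quasiMeasurePreserving.ae hp
  have hle : MulAction.orbitRel (Subgroup.zpowers (of a * of b * (of a)⁻¹ * (of b)⁻¹ * w)) X ≤
      MulAction.orbitRel (FreeGroup α) X := by
    rintro x y ⟨g, rfl⟩
    exact ⟨(g : FreeGroup α), rfl⟩
  refine ⟨hle, keptRel_le_orbitRel, ?_, ?_⟩
  · filter_upwards [hinv _ hD, hinv _ hD'] with x h1 h2
    exact orbitRel_le_sup_keptRel hab hw h1 h2
  · filter_upwards [hinv _ hD, hinv _ hD', hfree] with x₀ h1 h2 h3 n hn x hx0 hx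
    have hinj : ∀ g h : FreeGroup α, g • x₀ = h • x₀ → g = h := fun g h e => by
      have : h⁻¹ * g ∈ MulAction.stabilizer (FreeGroup α) x₀ := by
        rw [MulAction.mem_stabilizer_iff, mul_smul, e, inv_smul_smul]
      rw [h3, Subgroup.mem_bot, inv_mul_eq_one] at this
      exact this.symm
    by_contra! hne
    obtain ⟨F, hFS, hFκ⟩ := exists_separating_function hab hw hinj h1 h2
    have hR₁ : ∀ k : ℕ, MulAction.orbitRel
        (Subgroup.zpowers (of a * of b * (of a)⁻¹ * (of b)⁻¹ * w)) X
        (x ((2 * k + 1 : ℕ) : ZMod (2 * n))) (x ((2 * (k + 1) : ℕ) : ZMod (2 * n))) := fun k => by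
      have := (hx ((k + 1 : ℕ) : ZMod (2 * n))).1
      convert this using 2 <;> push_cast <;> ring
    have hR₂ : ∀ k : ℕ, keptRel a b D
        (x ((2 * k : ℕ) : ZMod (2 * n))) (x ((2 * k + 1 : ℕ) : ZMod (2 * n))) := fun k => by
      have := (hx (k : ZMod (2 * n))).2
      convert this using 2 <;> push_cast <;> ring
    have horb : ∀ k : ℕ, ∃ g : FreeGroup α, g • x₀ = x (k : ZMod (2 * n)) := by
      intro k
      induction k with
      | zero => exact ⟨1, by simp [hx0]⟩
      | succ k ih =>
        have hstep : MulAction.orbitRel (FreeGroup α) X (x (k : ZMod (2 * n)))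
            (x ((k + 1 : ℕ) : ZMod (2 * n))) := by
          obtain ⟨j, rfl | rfl⟩ := k.even_or_odd'
          · exact keptRel_le_orbitRel (hR₂ j)
          · exact hle (hR₁ j)
        obtain ⟨g, hg⟩ := ih
        obtain ⟨h, hh⟩ := Setoid.symm' _ hstep
        exact ⟨h * g, by rw [mul_smul, hg]; exact hh⟩
    choose g hg using horb
    have hgne : ∀ k, g k ≠ g (k + 1) := fun k e => hne k (by
      have := hg (k + 1)
      rw [← e, hg] at this
      simpa using this)
    refine alternating_path_ne hFκ g (fun i => (hFS _ _ ?_).symm) (fun i => hgne _)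
      (fun i => ?_) n hn ?_
    · rw [hg, hg]; exact hR₂ i
    · obtain ⟨⟨c, m, rfl⟩, hc⟩ := Setoid.symm' _ (hR₁ i)
      have e := hinj (g (2 * (i + 1))) ((of a * of b * (of a)⁻¹ * (of b)⁻¹ * w) ^ m *
        g (2 * i + 1)) (by rw [mul_smul, hg, hg]; exact hc.symm)
      refine ⟨m, ?_, e⟩
      rintro rfl
      rw [zpow_zero, one_mul] at e
      exact hgne (2 * i + 1) e.symm
    -- The path closes up because 2n = 0 in `ZMod (2 * n)`; freeness lifts this to the group
    -- elements.
    · congr 1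
      refine hinj _ _ ?_
      rw [hg, hg]
      simp

/-! ### Coin sequences: a model with a suitable rank -/

open scoped ENNReal

/-- The law of a fair coin. -/
noncomputable def coin : Measure Bool :=
  (2⁻¹ : ℝ≥0∞) • Measure.dirac true + (2⁻¹ : ℝ≥0∞) • Measure.dirac false

instance : IsProbabilityMeasure coin := ⟨by simp [coin, ENNReal.inv_two_add_inv_two]⟩

theorem coin_map_not : coin.map not = coin := by
  simp [coin, Measure.map_add, Measure.map_smul, add_comm,
    measurable_of_countable]

theorem coin_singleton_true : coin {true} = 2⁻¹ := by simp [coin]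

/-- The law of a sequence of independent fair coins indexed by the integers. -/
noncomputable abbrev coinSequence : Measure (ℤ → Bool) := Measure.infinitePi fun _ => coin

/-- The involution flipping the coordinate `0`. -/
def flipZero : Equiv.Perm (ℤ → Bool) :=
  Function.Involutive.toPerm (fun x i => (if i = 0 then not else id) (x i)) fun x => by
    ext i; by_cases h : i = 0 <;> simp [h]

/-- The shift of integer-indexed sequences. -/
def shiftRight : Equiv.Perm (ℤ → Bool) where
  toFun x i := x (i - 1)
  invFun x i := x (i + 1)
  left_inv x := by simp
  right_inv x := by simp

theorem measurePreserving_flipZero : MeasurePreserving flipZero coinSequence coinSequence := by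
  have hm : ∀ i : ℤ, Measurable (if i = 0 then not else id) := fun i => measurable_of_countable _
  refine ⟨measurable_pi_lambda _ fun i => (hm i).comp (measurable_pi_apply i), ?_⟩
  refine (Measure.infinitePi_map_pi (fun _ : ℤ => coin) hm).trans ?_
  congr 1
  ext1 i
  by_cases h : i = 0 <;> simp [h, coin_map_not]

theorem measurePreserving_shiftRight : MeasurePreserving shiftRight coinSequence coinSequence :=
  ⟨measurable_pi_lambda _ fun i => measurable_pi_apply (i - 1),
    Measure.map_infinitePi_infinitePi_of_inj (P := fun _ : ℤ => coin) (sub_left_injective (b := 1))⟩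

theorem measurePreserving_shiftRight_inv :
    MeasurePreserving (shiftRight⁻¹ : Equiv.Perm _) coinSequence coinSequence :=
  ⟨measurable_pi_lambda _ fun i => measurable_pi_apply (i + 1),
    Measure.map_infinitePi_infinitePi_of_inj (P := fun _ : ℤ => coin) (add_left_injective 1)⟩

/-- The number of consecutive `true` values of `x` at the positions `-1, -2, …`. -/
noncomputable def runLength (x : ℤ → Bool) : ℕ := sInf {k : ℕ | x (-(k + 1)) = false}

/-- The rank increased by flipping a `false` at `0` and by shifting a `true` away from `0`. -/
noncomputable def coinRank (x : ℤ → Bool) : ℕ := 2 * runLength x + if x 0 then 1 else 0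

theorem coinRank_lt_flipZero {x : ℤ → Bool} (hx : x 0 = false) :
    coinRank x < coinRank (flipZero⁻¹ x) := by
  have h0 : (flipZero⁻¹ x) 0 = true := by
    change (if (0 : ℤ) = 0 then not else id) (x 0) = true
    simp [hx]
  have h1 : runLength (flipZero⁻¹ x) = runLength x := by
    unfold runLength
    congr 1
  simp only [coinRank, h0, h1, hx, if_true, Bool.false_eq_true, if_false]
  omega

/-- Shifting moves the `true` at 0 to position -1 and lengthens the run by one. The factor 2 in the
rank outweighs the possible loss of the bit at 0. Without a `false` on the left the run length would
be the junk value `sInf ∅ = 0`. -/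
theorem coinRank_lt_shiftRight {x : ℤ → Bool} (hx : x 0 = true)
    (hx' : ∃ k : ℕ, x (-(k + 1)) = false) : coinRank x < coinRank (shiftRight⁻¹ x) := by
  have hs : ∀ i, (shiftRight⁻¹ x) i = x (i + 1) := fun _ => rfl
  have h1 : runLength x + 1 ≤ runLength (shiftRight⁻¹ x) := by
    refine le_csInf ?_ ?_
    · obtain ⟨k, hk⟩ := hx'
      refine ⟨k + 1, ?_⟩
      simp only [Set.mem_ofPred_eq, hs]
      simpa using hk
    · intro k hk
      simp only [Set.mem_ofPred_eq, hs] at hk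
      cases k with
      | zero => simp [hx] at hk
      | succ k =>
        refine Nat.succ_le_succ (Nat.sInf_le ?_)
        simpa using hk
  simp only [coinRank, hx, if_true]
  omega

theorem ae_exists_eq_false : ∀ᵐ x ∂coinSequence, ∃ k : ℕ, x (-(k + 1)) = false := by
  have hle : ∀ n : ℕ, coinSequence {x | ¬ ∃ k : ℕ, x (-(k + 1)) = false} ≤ (2⁻¹ : ℝ≥0∞) ^ n := by
    intro n
    let e : ℕ ↪ ℤ := ⟨fun k => -(k + 1), fun i j h => by simpa using h⟩
    calc _ ≤ coinSequence (Set.pi ((Finset.range n).map e) fun _ => {true}) := by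
          refine measure_mono fun x hx i hi => ?_
          obtain ⟨k, -, rfl⟩ := Finset.mem_map.1 (Finset.mem_coe.1 hi)
          simp only [Set.mem_ofPred_eq, not_exists, Bool.not_eq_false] at hx
          exact hx k
      _ = (2⁻¹ : ℝ≥0∞) ^ n := by
          rw [Measure.infinitePi_pi _ fun _ _ => MeasurableSet.singleton _]
          simp [coin_singleton_true]
  have hlim := ENNReal.tendsto_pow_atTop_nhds_zero_of_lt_one (r := 2⁻¹) (by simp)
  exact le_antisymm (ge_of_tendsto' hlim hle) bot_le

/-- Almost every point of the Bernoulli shift of a countable group over the unit interval has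
trivial stabilizer. -/
theorem ae_injective_bernoulli {Γ : Type*} [Group Γ] [Countable Γ] :
    ∀ᵐ y ∂(Measure.infinitePi fun _ : Γ => (volume : Measure unitInterval)),
      ∀ g : Γ, g ≠ 1 → y g⁻¹ ≠ y 1 := by
  refine ae_all_iff.2 fun g => ?_
  by_cases hg : g = 1
  · simp [hg]
  have h := Measure.infinitePi_map_eval_prod (P := fun _ : Γ => (volume : Measure unitInterval))
    (inv_ne_one.2 hg)
  have h0 : ((volume : Measure unitInterval).prod volume) {q | q.1 = q.2} = 0 := by
    rw [Measure.measure_prod_null (measurableSet_eq_fun measurable_fst measurable_snd)]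
    filter_upwards with x
    have : Prod.mk x ⁻¹' {q : unitInterval × unitInterval | q.1 = q.2} = {x} := by
      ext y; simp [eq_comm]
    rw [this]; simp
  rw [← h, Measure.map_apply (by fun_prop)
    (measurableSet_eq_fun measurable_fst measurable_snd)] at h0
  refine measure_mono_null (fun y hy => ?_) h0
  simp only [Set.mem_ofPred_eq, Set.mem_compl_iff, not_forall, not_not] at hy
  exact hy.2

/-! ### The action and the conclusion -/

theorem measurePreserving_lift {α X : Type*} [MeasurableSpace X] {μ : Measure X}
    {e : α → Equiv.Perm X} (he : ∀ s, MeasurePreserving (e s) μ μ)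
    (he' : ∀ s, MeasurePreserving ((e s)⁻¹ : Equiv.Perm X) μ μ) (g : FreeGroup α) :
    MeasurePreserving (FreeGroup.lift e g) μ μ := by
  induction g using FreeGroup.induction_on with
  | C1 => rw [_root_.map_one]; exact MeasurePreserving.id μ
  | of s => rw [FreeGroup.lift_apply_of]; exact he s
  | inv_of s _ => rw [_root_.map_inv, FreeGroup.lift_apply_of]; exact he' s
  | mul g h hg hh => rw [_root_.map_mul]; exact hg.comp hh

open FreeGroup in
theorem isMeasureFreeFactor_zpowers_commutator_mul {α : Type} [Countable α] {a b : α} (hab : a ≠ b)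
    {w : FreeGroup α} (hw : w ∈ Subgroup.closure (FreeGroup.of '' {s | s ≠ a ∧ s ≠ b})) :
    IsMeasureFreeFactor (Subgroup.zpowers (of a * of b * (of a)⁻¹ * (of b)⁻¹ * w)) := by
  classical
  -- Generators other than a and b may act trivially here, since freeness comes entirely from the
  -- Bernoulli factor.
  let e : α → Equiv.Perm (ℤ → Bool) := fun s =>
    if s = a then flipZero else if s = b then shiftRight else 1
  have hea : e a = flipZero := if_pos rfl
  have heb : e b = shiftRight := (if_neg hab.symm).trans (if_pos rfl)
  have hmp : ∀ g, MeasurePreserving (FreeGroup.lift e g) coinSequence coinSequence := by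
    refine measurePreserving_lift (fun s => ?_) (fun s => ?_) <;> simp only [e] <;> split_ifs
    · exact measurePreserving_flipZero
    · exact measurePreserving_shiftRight
    · exact MeasurePreserving.id _
    · exact measurePreserving_flipZero
    · exact measurePreserving_shiftRight_inv
    · exact MeasurePreserving.id _
  let : MulAction (FreeGroup α) (ℤ → Bool) := MulAction.compHom _ (FreeGroup.lift e)
  let : MulAction (FreeGroup α) (FreeGroup α → unitInterval) := arrowAction
  let ν : Measure (FreeGroup α → unitInterval) := Measure.infinitePi fun _ => volume
  have hmp' : ∀ g : FreeGroup α, MeasurePreserving (fun y : FreeGroup α → unitInterval => g • y)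
      ν ν := fun g =>
    ⟨measurable_pi_lambda _ fun h => measurable_pi_apply (g⁻¹ * h),
      Measure.map_infinitePi_infinitePi_of_inj
        (P := fun _ : FreeGroup α => (volume : Measure unitInterval)) (mul_right_injective g⁻¹)⟩
  have hprod : ∀ g : FreeGroup α, MeasurePreserving
      (fun q : (ℤ → Bool) × (FreeGroup α → unitInterval) => g • q)
      (coinSequence.prod ν) (coinSequence.prod ν) := fun g => (hmp g).prod (hmp' g)
  have : MeasurableConstSMul (FreeGroup α) ((ℤ → Bool) × (FreeGroup α → unitInterval)) :=
    ⟨fun g => (hprod g).measurable⟩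
  have : SMulInvariantMeasure (FreeGroup α) ((ℤ → Bool) × (FreeGroup α → unitInterval))
      (coinSequence.prod ν) :=
    ⟨fun g s hs => (hprod g).measure_preimage hs.nullMeasurableSet⟩
  have hfree : IsEssentiallyFree (FreeGroup α) (coinSequence.prod ν) := by
    filter_upwards [Measure.quasiMeasurePreserving_snd.ae
      (ae_injective_bernoulli (Γ := FreeGroup α))] with q hq
    refine (Subgroup.eq_bot_iff_forall _).2 fun g hg => ?_
    by_contra hne
    refine hq g hne ?_
    have h := congr_fun (congr_arg Prod.snd (MulAction.mem_stabilizer_iff.1 hg)) 1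
    change q.2 (g⁻¹ * 1) = q.2 1 at h
    rwa [mul_one] at h
  -- On D the inverse flip raises the rank; off D the inverse shift does, almost surely.
  let D : Set ((ℤ → Bool) × (FreeGroup α → unitInterval)) := {q | q.1 0 = false}
  have hDm : MeasurableSet D := measurableSet_eq_fun (by fun_prop) measurable_const
  have ha : ∀ q : (ℤ → Bool) × (FreeGroup α → unitInterval),
      ((of a)⁻¹ • q).1 = flipZero⁻¹ q.1 := fun q => by
    change FreeGroup.lift e (of a)⁻¹ q.1 = _
    rw [_root_.map_inv, FreeGroup.lift_apply_of, hea]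
  have hb : ∀ q : (ℤ → Bool) × (FreeGroup α → unitInterval),
      ((of b)⁻¹ • q).1 = shiftRight⁻¹ q.1 := fun q => by
    change FreeGroup.lift e (of b)⁻¹ q.1 = _
    rw [_root_.map_inv, FreeGroup.lift_apply_of, heb]
  refine ⟨(ℤ → Bool) × (FreeGroup α → unitInterval), inferInstance, inferInstance,
    coinSequence.prod ν, inferInstance, inferInstance, inferInstance, inferInstance, hfree,
    keptRel a b D, measurableSet_keptRel hDm,
    isFreeProductRel_keptRel _ hfree hab hw D (fun q => coinRank q.1) ?_ ?_⟩
  · filter_upwards with q hq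
    rw [ha]
    exact coinRank_lt_flipZero hq
  · filter_upwards [Measure.quasiMeasurePreserving_fst.ae ae_exists_eq_false] with q hq h
    rw [hb]
    exact coinRank_lt_shiftRight (by simpa [D] using h) hq

theorem isMeasureFreeFactor_of_subsingleton {Γ : Type*} [Group Γ] [Countable Γ] [Subsingleton Γ]
    (Λ : Subgroup Γ) : IsMeasureFreeFactor Λ := by
  let : MulAction Γ Unit := { smul := fun _ x => x, one_smul := fun _ => rfl,
                               mul_smul := fun _ _ _ => rfl }
  have : MeasurableConstSMul Γ Unit := ⟨fun _ => measurable_of_countable _⟩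
  have : SMulInvariantMeasure Γ Unit (Measure.dirac ()) := ⟨fun _ _ _ => rfl⟩
  refine ⟨Unit, inferInstance, inferInstance, Measure.dirac (), inferInstance, inferInstance,
    inferInstance, inferInstance, Filter.Eventually.of_forall fun _ => Subsingleton.elim _ _,
    ⊥, MeasurableSet.of_discrete, ?_, bot_le, ?_, ?_⟩
  · rintro x y -
    exact Setoid.refl' _ _
  · exact Filter.Eventually.of_forall fun x y _ => Setoid.refl' _ _
  · exact Filter.Eventually.of_forall fun x n _ z _ _ => ⟨0, rfl⟩

theorem mainTheorem2 (p : ℕ) :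
    IsMeasureFreeFactor (Subgroup.zpowers (prodCommutators p)) := by
  cases p with
  | zero => exact isMeasureFreeFactor_of_subsingleton _
  | succ p =>
    -- Only the first commutator is used actively; the remaining ones form w.
    have h := isMeasureFreeFactor_zpowers_commutator_mul (α := Fin (p + 1) ⊕ Fin (p + 1))
      (a := Sum.inl 0) (b := Sum.inr 0) (by simp)
      (w := (List.ofFn fun i : Fin p => FreeGroup.of (Sum.inl i.succ) *
        FreeGroup.of (Sum.inr i.succ) * (FreeGroup.of (Sum.inl i.succ))⁻¹ *
        (FreeGroup.of (Sum.inr i.succ))⁻¹).prod) (by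
        refine Subgroup.list_prod_mem _ fun x hx => ?_
        obtain ⟨i, rfl⟩ := List.mem_ofFn.1 hx
        have hl : FreeGroup.of (Sum.inl i.succ : Fin (p + 1) ⊕ Fin (p + 1)) ∈ Subgroup.closure
            (FreeGroup.of '' {s | s ≠ Sum.inl 0 ∧ s ≠ Sum.inr 0}) :=
          Subgroup.subset_closure ⟨_, by simp, rfl⟩
        have hr : FreeGroup.of (Sum.inr i.succ : Fin (p + 1) ⊕ Fin (p + 1)) ∈ Subgroup.closure
            (FreeGroup.of '' {s | s ≠ Sum.inl 0 ∧ s ≠ Sum.inr 0}) :=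
          Subgroup.subset_closure ⟨_, by simp, rfl⟩
        exact mul_mem (mul_mem (mul_mem hl hr) (inv_mem hl)) (inv_mem hr))
    rwa [prodCommutators, List.ofFn_succ, List.prod_cons]
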